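/- Let $n\ge 1$ and let $\Omega\subset\mathbb R^n$ be a bounded domain of class $C^2$. Let $\mu,c\in L^\infty(\Omega)$ and $h\in L^r(\Omega)$ for some $r>\max(1,n/2)$, where each of $\mu,c,h$ is nonnegative a.e. in $\Omega$ and not a.e. equal to $0$. For $\lambda\in\mathbb R$ consider the problem $$(P_\lambda)\qquad -\Delta u=\mu(x)|\nabla u|^2+\lambda c(x)u+h(x)\ \text{ in }\Omega,\qquad u\in H^1_0(\Omega)\cap L^\infty(\Omega),$$ where a solution is a weak solution, i.e. $\int_\Omega\nabla u\cdot\nabla\phi\,dx=\int_\Omega\big(\mu|\nabla u|^2+\lambda cu+h\big)\phi\,dx$ for all $\phi\in H^1_0(\Omega)\cap L^\infty(\Omega)$. Let $\gamma_1$ be the first (smallest) eigenvalue of the problem $-\Delta\varphi=\gamma\, c(x)\varphi$, $\varphi\in H^1_0(\Omega)$. Write $\|v\|_p=\big(\int_\Omega|v|^p\,dx\big)^{1/p}$ for $0<p<\infty$, and let $\|v\|_\infty$ be the essential supremum of $|v|$ on $\Omega$. Set $q=n/2$ if $n\ge3$, or fix any $q\in(1,\infty)$ if $n\le2$. Let $\varepsilon,\alpha,M>0$.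 Then there exists a constant $C_1>0$ such that, for every $\lambda\in[0,\gamma_1]$ and every nonnegative solution $u$ of $(P_\lambda)$, $$\|c\,u^{1+\varepsilon}\|_q+\|u\|_\alpha\le M\ \Longrightarrow\ \|u\|_\infty\le C_1 .$$ -/

import Mathlib

open MeasureTheory Filter Topology
open scoped ENNReal

noncomputable section

namespace GradientGrowth

/-- Euclidean space of dimension `n`. -/
abbrev E (n : ℕ) : Type := EuclideanSpace ℝ (Fin n)

/-- Lebesgue measure on `Ω`. -/
abbrev vol {n : ℕ} (Ω : Set (E n)) : Measure (E n) := volume.restrict Ω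

/-- A bounded domain (nonempty connected open set) of class `C²`: near every boundary point, `Ω` is
the strict sublevel set of a `C²` function whose differential at that point does not vanish
(equivalently, by the implicit function theorem, `Ω` lies locally on one side of a `C²` graph). -/
structure IsBoundedC2Domain {n : ℕ} (Ω : Set (E n)) : Prop where
  isOpen : IsOpen Ω
  isConnected : IsConnected Ω
  isBounded : Bornology.IsBounded Ω
  boundary : ∀ x ∈ frontier Ω, ∃ U : Set (E n), IsOpen U ∧ x ∈ U ∧
    ∃ ρ : E n → ℝ, ContDiffOn ℝ 2 ρ U ∧ fderiv ℝ ρ x ≠ 0 ∧ Ω ∩ U = {y ∈ U | ρ y < 0}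

/-- `φ ∈ C_c^∞(Ω)`. -/
structure IsTestFunction {n : ℕ} (Ω : Set (E n)) (φ : E n → ℝ) : Prop where
  smooth : ContDiff ℝ (⊤ : ℕ∞) φ
  compact : HasCompactSupport φ
  subset : tsupport φ ⊆ Ω

/-- `u ∈ H¹(Ω)` with weak gradient `G`. -/
structure MemH1 {n : ℕ} (Ω : Set (E n)) (u : E n → ℝ) (G : E n → E n) : Prop where
  memLp : MemLp u 2 (vol Ω)
  memLp_grad : MemLp G 2 (vol Ω)
  weak_grad : ∀ φ : E n → ℝ, IsTestFunction Ω φ → ∀ v : E n,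
    ∫ x in Ω, u x * fderiv ℝ φ x v = - ∫ x in Ω, inner ℝ (G x) v * φ x

/-- `u ∈ H¹₀(Ω)`, the closure of `C_c^∞(Ω)` in `H¹(Ω)`, with weak gradient `G`. -/
structure MemH10 {n : ℕ} (Ω : Set (E n)) (u : E n → ℝ) (G : E n → E n) : Prop where
  memH1 : MemH1 Ω u G
  approx : ∃ φ : ℕ → E n → ℝ, (∀ k, IsTestFunction Ω (φ k)) ∧
    Tendsto (fun k => eLpNorm (fun x => φ k x - u x) 2 (vol Ω)) atTop (𝓝 0) ∧
    Tendsto (fun k => eLpNorm (fun x => gradient (φ k) x - G x) 2 (vol Ω)) atTop (𝓝 0)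

/-- `u` is a (weak) solution of
`-Δu = μ(x) |∇u|² + lam c(x) u + h(x)`, `u ∈ H¹₀(Ω) ∩ L^∞(Ω)`:
the integral formulation holds for all test functions `φ ∈ H¹₀(Ω) ∩ L^∞(Ω)`. -/
def IsSolution {n : ℕ} (Ω : Set (E n)) (μ c h : E n → ℝ) (lam : ℝ) (u : E n → ℝ) : Prop :=
  ∃ G : E n → E n, MemH10 Ω u G ∧ MemLp u ∞ (vol Ω) ∧
    ∀ (φ : E n → ℝ) (Φ : E n → E n), MemH10 Ω φ Φ → MemLp φ ∞ (vol Ω) →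
      ∫ x in Ω, inner ℝ (G x) (Φ x) =
        ∫ x in Ω, (μ x * ‖G x‖ ^ 2 + lam * c x * u x + h x) * φ x

/-- `γ` is an eigenvalue of `-Δφ = γ c(x) φ`, `φ ∈ H¹₀(Ω)`: this problem has a weak solution
that is not a.e. zero. -/
def IsWeightedEigenvalue {n : ℕ} (Ω : Set (E n)) (c : E n → ℝ) (γ : ℝ) : Prop :=
  ∃ (φ : E n → ℝ) (G : E n → E n), MemH10 Ω φ G ∧ ¬ φ =ᵐ[vol Ω] 0 ∧
    ∀ (ψ : E n → ℝ) (Ψ : E n → E n), MemH10 Ω ψ Ψ →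
      ∫ x in Ω, inner ℝ (G x) (Ψ x) = γ * ∫ x in Ω, c x * φ x * ψ x

/-- The first eigenvalue `γ₁` of `-Δφ = γ c(x) φ`, `φ ∈ H¹₀(Ω)`. -/
def firstEigenvalue {n : ℕ} (Ω : Set (E n)) (c : E n → ℝ) : ℝ :=
  sInf {γ : ℝ | IsWeightedEigenvalue Ω c γ}

/-- `f ≥ 0` a.e. in `Ω` and `f` is not a.e. zero in `Ω`. -/
def NonnegNontrivial {n : ℕ} (Ω : Set (E n)) (f : E n → ℝ) : Prop :=
  0 ≤ᵐ[vol Ω] f ∧ ¬ f =ᵐ[vol Ω] 0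

end GradientGrowth

end

namespace GradientGrowth

open scoped NNReal

/-! Write `V = lam * c * u + h` and let `m` bound `μ`. The hypothesis on `c * u ^ (1 + ε)` bounds `c
* u` in `L^{q(1+ε)}`, so `V` is bounded in `L^p` for some `p > n/2`, uniformly in `lam` and `u`. The
gain `ε` is what lifts the critical exponent `n/2` strictly.

The quadratic gradient term is absorbed by testing with `exp (κ u) - 1`, `κ ≥ 2m`: differentiating
the exponential produces `κ ∫ exp (κ u) |∇u|²`, which dominates the contribution of `μ |∇u|²`
(`energy_estimate`). Hölder's inequality for `V` and Sobolev's inequality for `exp (κ u / 2) - 1`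
then give a reverse Hölder inequality for exponential means, with a constant affine in `κ`
(`exp_mean_step`). Moser iteration along a geometric sequence of `κ` yields `u ≤ log (∫ exp (b u)) /
b + D` with fixed `b`, `D` (`exists_ae_le_log_integral_exp`).

No a priori bound on `∫ exp (b u)` is available, but none is needed. If `B` is the right-hand side,
then `u ≤ B`, while the mean of `exp (b u)` is comparable to `exp (b B)`. Hence `u` lies within a
fixed distance of `B` on a set of measure bounded below, and the `L^α` bound limits `B`
(`exists_ae_le_of_eLpNorm_le`). -/

theorem norm_gradient_eq {n : ℕ} (φ : E n → ℝ) (x : E n) : ‖gradient φ x‖ = ‖fderiv ℝ φ x‖ := by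
  simp [gradient]

theorem eLpNorm_gradient_eq {n : ℕ} (φ : E n → ℝ) (p : ℝ≥0∞) (ν : Measure (E n)) :
    eLpNorm (gradient φ) p ν = eLpNorm (fderiv ℝ φ) p ν :=
  eLpNorm_congr_norm_ae (Eventually.of_forall fun x => norm_gradient_eq φ x)

theorem isFiniteMeasure_vol {n : ℕ} {Ω : Set (E n)} (hb : Bornology.IsBounded Ω) :
    IsFiniteMeasure (vol Ω) :=
  isFiniteMeasure_restrict.2 hb.measure_lt_top.ne

theorem eLpNorm_vol_of_support_subset {n : ℕ} {Ω : Set (E n)} {F : Type*} [NormedAddCommGroup F]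
    {f : E n → F} (hf : Function.support f ⊆ Ω) (p : ℝ≥0∞) :
    eLpNorm f p (vol Ω) = eLpNorm f p volume :=
  eLpNorm_restrict_eq_of_support_subset hf

/-! ### Test functions -/

namespace IsTestFunction

variable {n : ℕ} {Ω : Set (E n)} {φ : E n → ℝ}

theorem support_subset (hφ : IsTestFunction Ω φ) : Function.support φ ⊆ Ω :=
  (subset_tsupport φ).trans hφ.subset

theorem support_fderiv_subset (hφ : IsTestFunction Ω φ) : Function.support (fderiv ℝ φ) ⊆ Ω :=
  (_root_.support_fderiv_subset ℝ).trans hφ.subset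

theorem contDiff_one (hφ : IsTestFunction Ω φ) : ContDiff ℝ 1 φ :=
  hφ.smooth.of_le (by exact_mod_cast le_top)

theorem continuous_fderiv (hφ : IsTestFunction Ω φ) : Continuous (fderiv ℝ φ) :=
  hφ.contDiff_one.continuous_fderiv one_ne_zero

theorem continuous_gradient (hφ : IsTestFunction Ω φ) : Continuous (gradient φ) :=
  (InnerProductSpace.toDual ℝ (E n)).symm.continuous.comp hφ.continuous_fderiv

theorem memLp (hφ : IsTestFunction Ω φ) (p : ℝ≥0∞) : MemLp φ p (vol Ω) :=
  (hφ.smooth.continuous.memLp_of_hasCompactSupport hφ.compact).restrict _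

theorem memLp_gradient (hφ : IsTestFunction Ω φ) (p : ℝ≥0∞) : MemLp (gradient φ) p (vol Ω) := by
  refine (hφ.continuous_gradient.memLp_of_hasCompactSupport ?_).restrict _
  exact (hφ.compact.fderiv ℝ).comp_left (map_zero _)

theorem weak_grad (hφ : IsTestFunction Ω φ) {ψ : E n → ℝ} (hψ : IsTestFunction Ω ψ) (v : E n) :
    ∫ x in Ω, φ x * fderiv ℝ ψ x v = - ∫ x in Ω, inner ℝ (gradient φ x) v * ψ x := by
  have e1 : ∫ x in Ω, φ x * fderiv ℝ ψ x v = ∫ x, φ x * fderiv ℝ ψ x v := by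
    refine setIntegral_eq_integral_of_forall_compl_eq_zero fun x hx => ?_
    rw [Function.notMem_support.1 fun h => hx (hφ.support_subset h), zero_mul]
  have e2 : ∫ x in Ω, inner ℝ (gradient φ x) v * ψ x = ∫ x, fderiv ℝ φ x v * ψ x := by
    rw [setIntegral_eq_integral_of_forall_compl_eq_zero]
    · simp [gradient]
    · intro x hx
      rw [Function.notMem_support.1 fun h => hx (hψ.support_subset h), mul_zero]
  have c1 := hφ.smooth.continuous
  have c2 := hψ.smooth.continuous
  have c3 : Continuous fun x => fderiv ℝ φ x v := hφ.continuous_fderiv.clm_apply continuous_const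
  have c4 : Continuous fun x => fderiv ℝ ψ x v := hψ.continuous_fderiv.clm_apply continuous_const
  rw [e1, e2]
  refine integral_mul_fderiv_eq_neg_fderiv_mul_of_integrable ?_ ?_ ?_ ?_ ?_
  · exact (c3.mul c2).integrable_of_hasCompactSupport hψ.compact.mul_left
  · exact (c1.mul c4).integrable_of_hasCompactSupport hφ.compact.mul_right
  · exact (c1.mul c2).integrable_of_hasCompactSupport hφ.compact.mul_right
  · exact fun x _ => hφ.contDiff_one.differentiable one_ne_zero x
  · exact fun x _ => hψ.contDiff_one.differentiable one_ne_zero x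

end IsTestFunction

/-! ### Sobolev inequality for test functions -/

theorem IsTestFunction.eLpNorm_le_of_dim_one {Ω : Set (E 1)} {φ : E 1 → ℝ}
    (hφ : IsTestFunction Ω φ) : eLpNorm φ ∞ (vol Ω) ≤ eLpNorm (gradient φ) 1 (vol Ω) := by
  let e : ℝ ≃ₗᵢ[ℝ] E 1 := (OrthonormalBasis.singleton (Fin 1) ℝ).repr
  have he : MeasurePreserving e volume volume := e.measurePreserving
  have hf : ContDiff ℝ 1 (φ ∘ e) := hφ.contDiff_one.comp e.contDiff
  have hc : HasCompactSupport (φ ∘ e) := hφ.compact.comp_homeomorph e.toHomeomorph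
  have hd : ∀ t, ‖deriv (φ ∘ e) t‖ₑ ≤ ‖fderiv ℝ φ (e t)‖ₑ := by
    intro t
    have h1 : HasFDerivAt φ (fderiv ℝ φ (e t)) (e t) :=
      (hφ.contDiff_one.differentiable one_ne_zero _).hasFDerivAt
    have h2 : HasDerivAt e (e 1) t := by
      have := (e.toContinuousLinearEquiv : ℝ →L[ℝ] E 1).hasDerivAt (x := t)
      simpa using this
    rw [(h1.comp_hasDerivAt t h2).deriv, ← ofReal_norm, ← ofReal_norm]
    refine ENNReal.ofReal_le_ofReal ?_
    simpa using (fderiv ℝ φ (e t)).le_opNorm (e 1)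
  rw [eLpNorm_gradient_eq, eLpNorm_exponent_top]
  refine eLpNormEssSup_le_of_ae_enorm_bound (Eventually.of_forall fun x => ?_)
  obtain ⟨t, rfl⟩ := e.surjective x
  calc ‖φ (e t)‖ₑ ≤ ∫⁻ y in Set.Iic t, ‖deriv (φ ∘ e) y‖ₑ :=
        hc.enorm_le_lintegral_Ici_deriv hf t
    _ ≤ ∫⁻ y, ‖deriv (φ ∘ e) y‖ₑ := setLIntegral_le_lintegral _ _
    _ ≤ ∫⁻ y, ‖fderiv ℝ φ (e y)‖ₑ := lintegral_mono hd
    _ = ∫⁻ y, ‖fderiv ℝ φ y‖ₑ :=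
        he.lintegral_comp hφ.continuous_fderiv.enorm.measurable
    _ = eLpNorm (fderiv ℝ φ) 1 (vol Ω) := by
        rw [eLpNorm_vol_of_support_subset hφ.support_fderiv_subset,
          eLpNorm_one_eq_lintegral_enorm]

/-- Sobolev inequality for test functions of a bounded set. -/
theorem exists_eLpNorm_le_eLpNorm_gradient {n : ℕ} (hn : 1 ≤ n) {Ω : Set (E n)}
    (hb : Bornology.IsBounded Ω) {s : ℝ} (hs : 2 ≤ s)
    (hs3 : 3 ≤ n → s⁻¹ = 2⁻¹ - (n : ℝ)⁻¹) :
    ∃ S : ℝ≥0∞, S ≠ ∞ ∧ ∀ φ, IsTestFunction Ω φ →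
      eLpNorm φ (ENNReal.ofReal s) (vol Ω) ≤ S * eLpNorm (gradient φ) 2 (vol Ω) := by
  have := isFiniteMeasure_vol hb
  have hfin : ∀ a : ℝ, 0 ≤ a → (vol Ω) Set.univ ^ a ≠ ∞ := fun a ha =>
    ENNReal.rpow_ne_top_of_nonneg ha (measure_ne_top _ _)
  have hs0 : 0 < s := by linarith
  have key : ∀ p : ℝ≥0, 1 ≤ p → p ≤ 2 → ∃ A : ℝ≥0∞, A ≠ ∞ ∧ ∀ φ, IsTestFunction Ω φ →
      eLpNorm (gradient φ) p (vol Ω) ≤ eLpNorm (gradient φ) 2 (vol Ω) * A := by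
    intro p hp1 hp2
    have hp0 : (0 : ℝ) < p := by exact_mod_cast zero_lt_one.trans_le hp1
    have hp2' : (p : ℝ) ≤ 2 := by exact_mod_cast hp2
    refine ⟨(vol Ω) Set.univ ^ (1 / (p : ℝ≥0∞).toReal - 1 / (2 : ℝ≥0∞).toReal), hfin _ ?_, ?_⟩
    · simp only [ENNReal.coe_toReal, ENNReal.toReal_ofNat, sub_nonneg]
      exact one_div_le_one_div_of_le hp0 hp2'
    · intro φ hφ
      exact eLpNorm_le_eLpNorm_mul_rpow_measure_univ (by exact_mod_cast hp2)
        hφ.continuous_gradient.aestronglyMeasurable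
  rcases Nat.lt_or_ge n 2 with h2 | h2
  -- In dimension one the supremum is controlled by the `L¹` norm of the derivative, so every `s` is
  -- admissible.
  · obtain rfl : n = 1 := by omega
    obtain ⟨A, hA, hA'⟩ := key 1 le_rfl one_le_two
    refine ⟨A * (vol Ω) Set.univ ^ (1 / (ENNReal.ofReal s).toReal - 1 / (∞ : ℝ≥0∞).toReal),
      ENNReal.mul_ne_top hA (hfin _ (by simp)), fun φ hφ => ?_⟩
    calc _ ≤ eLpNorm φ ∞ (vol Ω) * _ := eLpNorm_le_eLpNorm_mul_rpow_measure_univ le_top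
            hφ.smooth.continuous.aestronglyMeasurable
      _ ≤ (eLpNorm (gradient φ) 2 (vol Ω) * A) * _ := by
          gcongr; exact hφ.eLpNorm_le_of_dim_one.trans (hA' φ hφ)
      _ = _ := by ring
  · obtain ⟨p, hp1, hp2, hpn, hps⟩ : ∃ p : ℝ≥0, 1 ≤ p ∧ p ≤ 2 ∧ (p : ℝ) < n ∧
        (p : ℝ)⁻¹ - (n : ℝ)⁻¹ ≤ s⁻¹ := by
      rcases h2.eq_or_lt with h2 | h2
      · subst h2
        -- In dimension two, `2s/(s+2) < 2` is the exponent whose Sobolev conjugate is `s`; `key`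
        -- returns to the `L²` norm of the gradient.
        have h1 : 1 ≤ 2 * s / (s + 2) := by rw [le_div_iff₀ (by linarith)]; linarith
        have h2 : 2 * s / (s + 2) < 2 := by rw [div_lt_iff₀ (by linarith)]; linarith
        refine ⟨⟨2 * s / (s + 2), by positivity⟩, ?_, ?_, ?_, ?_⟩
        · exact_mod_cast h1
        · exact_mod_cast h2.le
        · exact_mod_cast h2
        · change (2 * s / (s + 2))⁻¹ - _ ≤ _
          apply le_of_eq
          field_simp
          push_cast
          ring
      · refine ⟨2, one_le_two, le_rfl, by exact_mod_cast h2, ?_⟩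
        rw [hs3 h2]; simp
    obtain ⟨A, hA, hA'⟩ := key p hp1 hp2
    refine ⟨eLpNormLESNormFDerivOfLeConst ℝ (volume : Measure (E n)) Ω p s.toNNReal * A,
      ENNReal.mul_ne_top ENNReal.coe_ne_top hA, fun φ hφ => ?_⟩
    have h := eLpNorm_le_eLpNorm_fderiv_of_le (volume : Measure (E n)) (p := p) (q := s.toNNReal)
      hφ.contDiff_one hφ.support_subset hp1 (by rw [finrank_euclideanSpace_fin]; exact_mod_cast hpn)
      (by simpa [hs0.le] using hps) hb
    have h' := hA' φ hφ
    rw [eLpNorm_gradient_eq φ p, eLpNorm_vol_of_support_subset hφ.support_fderiv_subset]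
      at h'
    rw [eLpNorm_vol_of_support_subset hφ.support_subset]
    calc _ ≤ _ := h
      _ ≤ _ * (eLpNorm (gradient φ) 2 (vol Ω) * A) := by gcongr
      _ = _ := by ring

/-! ### The space `H¹₀`: limits, Sobolev inequality, chain rule -/

/-- On a finite measure space `L²` convergence implies `L¹` convergence, which the pointwise
Lipschitz bound transfers from `f` to `g`. It serves to pass to the limit in the weak gradient
identity. -/
theorem tendsto_integral_of_norm_sub_le {α F : Type*} [MeasurableSpace α] [NormedAddCommGroup F]
    {ν : Measure α} [IsFiniteMeasure ν] {f : ℕ → α → F} {f₀ : α → F} {g : ℕ → α → ℝ} {g₀ : α → ℝ}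
    (hf : ∀ k, MemLp (f k) 2 ν) (hf₀ : MemLp f₀ 2 ν)
    (hlim : Tendsto (fun k => eLpNorm (fun x => f k x - f₀ x) 2 ν) atTop (𝓝 0))
    (hg : ∀ k, Integrable (g k) ν) (hg₀ : Integrable g₀ ν) (C : ℝ)
    (hC : ∀ k x, ‖g k x - g₀ x‖ ≤ C * ‖f k x - f₀ x‖) :
    Tendsto (fun k => ∫ x, g k x ∂ν) atTop (𝓝 (∫ x, g₀ x ∂ν)) := by
  refine tendsto_integral_of_L1 _ hg₀.1 (Eventually.of_forall hg) ?_
  set D := ENNReal.ofReal C * ν Set.univ ^ (1 / (1 : ℝ≥0∞).toReal - 1 / (2 : ℝ≥0∞).toReal) with hD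
  have hDfin : D ≠ ∞ := ENNReal.mul_ne_top ENNReal.ofReal_ne_top
    (ENNReal.rpow_ne_top_of_nonneg (by norm_num) (measure_ne_top _ _))
  refine tendsto_of_tendsto_of_tendsto_of_le_of_le tendsto_const_nhds
    (h := fun k => D * eLpNorm (fun x => f k x - f₀ x) 2 ν) ?_ (fun _ => zero_le) fun k => ?_
  · simpa using ENNReal.Tendsto.const_mul hlim (Or.inr hDfin)
  · calc ∫⁻ x, ‖g k x - g₀ x‖ₑ ∂ν = eLpNorm (fun x => g k x - g₀ x) 1 ν := by
          rw [eLpNorm_one_eq_lintegral_enorm]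
      _ ≤ ENNReal.ofReal C * eLpNorm (fun x => f k x - f₀ x) 1 ν :=
          eLpNorm_le_mul_eLpNorm_of_ae_le_mul (Eventually.of_forall (hC k)) 1
      _ ≤ ENNReal.ofReal C * (eLpNorm (fun x => f k x - f₀ x) 2 ν * _) := by
          gcongr
          exact eLpNorm_le_eLpNorm_mul_rpow_measure_univ one_le_two
            ((hf k).1.sub hf₀.1)
      _ = _ := by rw [hD]; ring

/-- A limit of test functions in the `H¹` norm belongs to `H¹₀`. -/
theorem memH10_of_approx {n : ℕ} {Ω : Set (E n)} (hb : Bornology.IsBounded Ω)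
    {u : E n → ℝ} {G : E n → E n} (hu : MemLp u 2 (vol Ω)) (hG : MemLp G 2 (vol Ω))
    {φ : ℕ → E n → ℝ} (hφ : ∀ k, IsTestFunction Ω (φ k))
    (h1 : Tendsto (fun k => eLpNorm (fun x => φ k x - u x) 2 (vol Ω)) atTop (𝓝 0))
    (h2 : Tendsto (fun k => eLpNorm (fun x => gradient (φ k) x - G x) 2 (vol Ω)) atTop (𝓝 0)) :
    MemH10 Ω u G := by
  have := isFiniteMeasure_vol hb
  refine ⟨⟨hu, hG, fun ψ hψ v => ?_⟩, φ, hφ, h1, h2⟩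
  have cψ := hψ.smooth.continuous
  have cψ' : Continuous fun x => fderiv ℝ ψ x v := hψ.continuous_fderiv.clm_apply continuous_const
  obtain ⟨C₁, hC₁⟩ := cψ.bounded_above_of_compact_support hψ.compact
  obtain ⟨C₂, hC₂⟩ := cψ'.bounded_above_of_compact_support (hψ.compact.fderiv_apply ℝ v)
  have t1 : Tendsto (fun k => ∫ x in Ω, φ k x * fderiv ℝ ψ x v) atTop
      (𝓝 (∫ x in Ω, u x * fderiv ℝ ψ x v)) := by
    refine tendsto_integral_of_norm_sub_le (fun k => (hφ k).memLp 2) hu h1 (fun k => ?_) ?_ C₂ ?_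
    · exact (((hφ k).memLp 2).integrable one_le_two).mul_bdd (c := C₂) cψ'.aestronglyMeasurable
        (Eventually.of_forall hC₂)
    · exact (hu.integrable one_le_two).mul_bdd (c := C₂) cψ'.aestronglyMeasurable
        (Eventually.of_forall hC₂)
    · intro k x
      rw [← sub_mul, norm_mul, mul_comm]
      exact mul_le_mul_of_nonneg_right (hC₂ x) (norm_nonneg _)
  have t2 : Tendsto (fun k => ∫ x in Ω, inner ℝ (gradient (φ k) x) v * ψ x) atTop
      (𝓝 (∫ x in Ω, inner ℝ (G x) v * ψ x)) := by
    refine tendsto_integral_of_norm_sub_le (fun k => (hφ k).memLp_gradient 2) hG h2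
      (fun k => ?_) ?_ (‖v‖ * C₁) ?_
    · exact ((((hφ k).memLp_gradient 2).integrable one_le_two).inner_const v).mul_bdd (c := C₁)
        cψ.aestronglyMeasurable (Eventually.of_forall hC₁)
    · exact ((hG.integrable one_le_two).inner_const v).mul_bdd (c := C₁)
        cψ.aestronglyMeasurable (Eventually.of_forall hC₁)
    · intro k x
      rw [← sub_mul, ← inner_sub_left, norm_mul]
      calc _ ≤ (‖gradient (φ k) x - G x‖ * ‖v‖) * C₁ :=
            mul_le_mul (norm_inner_le_norm _ _) (hC₁ x) (norm_nonneg _) (by positivity)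
        _ = _ := by ring
  refine tendsto_nhds_unique t1 ?_
  simpa only [(hφ _).weak_grad hψ v] using t2.neg

theorem MemH10.exists_approx_ae {n : ℕ} {Ω : Set (E n)} {u : E n → ℝ} {G : E n → E n}
    (hu : MemH10 Ω u G) : ∃ φ : ℕ → E n → ℝ, (∀ k, IsTestFunction Ω (φ k)) ∧
      Tendsto (fun k => eLpNorm (fun x => φ k x - u x) 2 (vol Ω)) atTop (𝓝 0) ∧
      Tendsto (fun k => eLpNorm (fun x => gradient (φ k) x - G x) 2 (vol Ω)) atTop (𝓝 0) ∧
      ∀ᵐ x ∂vol Ω, Tendsto (fun k => φ k x) atTop (𝓝 (u x)) := by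
  obtain ⟨φ, hφ, h1, h2⟩ := hu.approx
  have hm : TendstoInMeasure (vol Ω) φ atTop u :=
    tendstoInMeasure_of_tendsto_eLpNorm two_ne_zero
      (fun k => (hφ k).smooth.continuous.aestronglyMeasurable) hu.memH1.memLp.1 h1
  obtain ⟨ns, hns, hae⟩ := hm.exists_seq_tendsto_ae
  exact ⟨fun k => φ (ns k), fun k => hφ _, h1.comp hns.tendsto_atTop, h2.comp hns.tendsto_atTop,
    hae⟩

/-- A Sobolev inequality for test functions extends to `H¹₀`. -/
theorem MemH10.eLpNorm_le {n : ℕ} {Ω : Set (E n)} {p S : ℝ≥0∞} (hS : S ≠ ∞)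
    (hSob : ∀ φ, IsTestFunction Ω φ →
      eLpNorm φ p (vol Ω) ≤ S * eLpNorm (gradient φ) 2 (vol Ω))
    {u : E n → ℝ} {G : E n → E n} (hu : MemH10 Ω u G) :
    eLpNorm u p (vol Ω) ≤ S * eLpNorm G 2 (vol Ω) := by
  obtain ⟨φ, hφ, -, h2, hae⟩ := hu.exists_approx_ae
  -- Fatou's lemma: the norm is lower semicontinuous along an a.e. convergent sequence.
  refine (Lp.eLpNorm_lim_le_liminf_eLpNorm
    (fun k => (hφ k).smooth.continuous.aestronglyMeasurable) _ hae).trans ?_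
  have hlim : Tendsto (fun k => S * (eLpNorm (fun x => gradient (φ k) x - G x) 2 (vol Ω) +
      eLpNorm G 2 (vol Ω))) atTop (𝓝 (S * (0 + eLpNorm G 2 (vol Ω)))) :=
    ENNReal.Tendsto.const_mul (h2.add_const _) (Or.inr hS)
  rw [zero_add] at hlim
  rw [← hlim.liminf_eq]
  refine liminf_le_liminf (Eventually.of_forall fun k => (hSob _ (hφ k)).trans ?_)
  gcongr
  have hG := hu.memH1.memLp_grad.1
  calc eLpNorm (gradient (φ k)) 2 (vol Ω)
      = eLpNorm ((fun x => gradient (φ k) x - G x) + G) 2 (vol Ω) := by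
        congr 1; ext1 x; simp
    _ ≤ _ := eLpNorm_add_le ((hφ k).continuous_gradient.aestronglyMeasurable.sub hG) hG one_le_two

theorem MemH10.congr {n : ℕ} {Ω : Set (E n)} (hb : Bornology.IsBounded Ω) {u u' : E n → ℝ}
    {G G' : E n → E n} (hu : MemH10 Ω u G) (h : u =ᵐ[vol Ω] u') (hG : G =ᵐ[vol Ω] G') :
    MemH10 Ω u' G' := by
  obtain ⟨φ, hφ, h1, h2⟩ := hu.approx
  refine memH10_of_approx hb (hu.memH1.memLp.ae_eq h) (hu.memH1.memLp_grad.ae_eq hG) hφ ?_ ?_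
  · refine h1.congr fun k => eLpNorm_congr_ae ?_
    filter_upwards [h] with x hx
    rw [hx]
  · refine h2.congr fun k => eLpNorm_congr_ae ?_
    filter_upwards [hG] with x hx
    rw [hx]

theorem IsTestFunction.comp {n : ℕ} {Ω : Set (E n)} {φ : E n → ℝ} (hφ : IsTestFunction Ω φ)
    {F : ℝ → ℝ} (hF : ContDiff ℝ (⊤ : ℕ∞) F) (h0 : F 0 = 0) : IsTestFunction Ω (F ∘ φ) :=
  ⟨hF.comp hφ.smooth, hφ.compact.comp_left h0,
    (closure_mono (Function.support_comp_subset h0 φ)).trans hφ.subset⟩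

theorem IsTestFunction.gradient_comp {n : ℕ} {Ω : Set (E n)} {φ : E n → ℝ}
    (hφ : IsTestFunction Ω φ) {F : ℝ → ℝ} (hF : ContDiff ℝ (⊤ : ℕ∞) F) (x : E n) :
    gradient (F ∘ φ) x = deriv F (φ x) • gradient φ x := by
  have h1 : HasDerivAt F (deriv F (φ x)) (φ x) :=
    (hF.differentiable (by simp) _).hasDerivAt
  have h2 : HasFDerivAt φ (fderiv ℝ φ x) x :=
    (hφ.contDiff_one.differentiable one_ne_zero x).hasFDerivAt
  simp [gradient, (h1.comp_hasFDerivAt x h2).fderiv]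

/-- Chain rule in `H¹₀` for smooth functions with bounded derivative. -/
theorem MemH10.comp_of_deriv_bounded {n : ℕ} {Ω : Set (E n)} (hb : Bornology.IsBounded Ω)
    {u : E n → ℝ} {G : E n → E n} (hu : MemH10 Ω u G) {F : ℝ → ℝ}
    (hF : ContDiff ℝ (⊤ : ℕ∞) F) (h0 : F 0 = 0) {C : ℝ} (hC : ∀ t, ‖deriv F t‖ ≤ C) :
    MemH10 Ω (F ∘ u) (fun x => deriv F (u x) • G x) := by
  obtain ⟨φ, hφ, h1, h2, hae⟩ := hu.exists_approx_ae
  have hC0 : 0 ≤ C := (norm_nonneg _).trans (hC 0)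
  have hFd : Differentiable ℝ F := hF.differentiable (by simp)
  have cF' : Continuous (deriv F) := hF.continuous_deriv (by simp)
  have hlip : ∀ s t, ‖F s - F t‖ ≤ C * ‖s - t‖ := fun s t =>
    convex_univ.norm_image_sub_le_of_norm_deriv_le (fun y _ => hFd y) (fun y _ => hC y)
      (Set.mem_univ t) (Set.mem_univ s)
  have hum := hu.memH1.memLp.1
  have hGm := hu.memH1.memLp_grad.1
  have hF'u : AEStronglyMeasurable (fun x => deriv F (u x)) (vol Ω) :=
    cF'.comp_aestronglyMeasurable hum
  refine memH10_of_approx hb ?_ ?_ (fun k => (hφ k).comp hF h0) ?_ ?_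
  · refine hu.memH1.memLp.of_le_mul (c := C) (hFd.continuous.comp_aestronglyMeasurable hum)
      (Eventually.of_forall fun x => ?_)
    simpa [h0] using hlip (u x) 0
  · refine hu.memH1.memLp_grad.of_le_mul (c := C) (hF'u.smul hGm)
      (Eventually.of_forall fun x => ?_)
    rw [norm_smul]
    exact mul_le_mul_of_nonneg_right (hC _) (norm_nonneg _)
  · refine tendsto_of_tendsto_of_tendsto_of_le_of_le tendsto_const_nhds
      (h := fun k => ENNReal.ofReal C * eLpNorm (fun x => φ k x - u x) 2 (vol Ω)) ?_
      (fun _ => zero_le) fun k => ?_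
    · simpa using ENNReal.Tendsto.const_mul h1 (Or.inr ENNReal.ofReal_ne_top)
    · exact eLpNorm_le_mul_eLpNorm_of_ae_le_mul (Eventually.of_forall fun x => hlip _ _) 2
  · have hA : Tendsto (fun k => ENNReal.ofReal C *
        eLpNorm (fun x => gradient (φ k) x - G x) 2 (vol Ω)) atTop (𝓝 0) := by
      simpa using ENNReal.Tendsto.const_mul h2 (Or.inr ENNReal.ofReal_ne_top)
    -- Here `G` is fixed and its bounded coefficient tends to `0` a.e., so dominated convergence
    -- applies with majorant `|2 C G|²`.
    have hB : Tendsto (fun k => eLpNorm (fun x => (deriv F (φ k x) - deriv F (u x)) • G x) 2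
        (vol Ω)) atTop (𝓝 0) := by
      have hL : Tendsto (fun k => ∫⁻ x, ‖(deriv F (φ k x) - deriv F (u x)) • G x‖ₑ ^ (2 : ℝ)
          ∂(vol Ω)) atTop (𝓝 (∫⁻ _, 0 ∂(vol Ω))) := by
        refine tendsto_lintegral_of_dominated_convergence'
          (fun x => ‖(2 * C) • G x‖ₑ ^ (2 : ℝ)) (fun k => ?_) (fun k => ?_) ?_ ?_
        · exact ((((cF'.comp (hφ k).smooth.continuous).aestronglyMeasurable.sub hF'u).smul
            hGm).enorm.pow_const _)
        · refine Eventually.of_forall fun x => ?_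
          refine ENNReal.rpow_le_rpow (enorm_le_iff_norm_le.2 ?_) zero_le_two
          rw [norm_smul, norm_smul, Real.norm_of_nonneg (by positivity : 0 ≤ 2 * C)]
          refine mul_le_mul_of_nonneg_right ?_ (norm_nonneg _)
          calc _ ≤ ‖deriv F (φ k x)‖ + ‖deriv F (u x)‖ := norm_sub_le _ _
            _ ≤ C + C := add_le_add (hC _) (hC _)
            _ = _ := by ring
        · have hm : MemLp (fun x => (2 * C) • G x) 2 (vol Ω) :=
            hu.memH1.memLp_grad.const_smul (2 * C)
          have := lintegral_rpow_enorm_lt_top_of_eLpNorm_lt_top two_ne_zero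
            ENNReal.ofNat_ne_top hm.2
          simpa using this.ne
        · filter_upwards [hae] with x hx
          have : Tendsto (fun k => (deriv F (φ k x) - deriv F (u x)) • G x) atTop (𝓝 0) := by
            have := ((((cF'.tendsto _).comp hx).sub_const (deriv F (u x))).smul_const (G x))
            simpa using this
          have h3 := (ENNReal.continuous_rpow_const (y := 2)).tendsto _ |>.comp this.enorm
          simpa [Function.comp_def] using h3
      rw [lintegral_zero] at hL
      have h4 := (ENNReal.continuous_rpow_const (y := 1 / 2)).tendsto _ |>.comp hL
      simp only [eLpNorm_eq_lintegral_rpow_enorm_toReal two_ne_zero ENNReal.ofNat_ne_top]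
      simpa [Function.comp_def] using h4
    have hAB := hA.add hB
    rw [add_zero] at hAB
    refine tendsto_of_tendsto_of_tendsto_of_le_of_le tendsto_const_nhds hAB
      (fun _ => zero_le) fun k => ?_
    have hsplit : (fun x => gradient (F ∘ φ k) x - deriv F (u x) • G x) =
        (fun x => deriv F (φ k x) • (gradient (φ k) x - G x)) +
          fun x => (deriv F (φ k x) - deriv F (u x)) • G x := by
      funext x
      rw [(hφ k).gradient_comp hF, Pi.add_apply, smul_sub, sub_smul]
      abel
    have hFk := (cF'.comp (hφ k).smooth.continuous).aestronglyMeasurable (μ := vol Ω)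
    rw [hsplit]
    refine (eLpNorm_add_le (hFk.smul ((hφ k).continuous_gradient.aestronglyMeasurable.sub hGm))
      ((hFk.sub hF'u).smul hGm) one_le_two).trans (add_le_add_left ?_ _)
    refine eLpNorm_le_mul_eLpNorm_of_ae_le_mul (Eventually.of_forall fun x => ?_) 2
    rw [Pi.smul_apply', norm_smul]
    exact mul_le_mul_of_nonneg_right (hC _) (norm_nonneg _)

theorem exists_ae_abs_le {α : Type*} [MeasurableSpace α] {ν : Measure α} {u : α → ℝ}
    (hu : MemLp u ∞ ν) : ∃ R : ℝ, 0 < R ∧ ∀ᵐ x ∂ν, |u x| ≤ R := by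
  refine ⟨(eLpNorm u ∞ ν).toReal + 1, by positivity, ?_⟩
  filter_upwards [ae_le_eLpNormEssSup (f := u) (μ := ν)] with x hx
  rw [← eLpNorm_exponent_top] at hx
  have := ENNReal.toReal_mono hu.2.ne hx
  rw [toReal_enorm, Real.norm_eq_abs] at this
  linarith

/-- Chain rule in `H¹₀ ∩ L^∞` for smooth functions. -/
theorem MemH10.comp {n : ℕ} {Ω : Set (E n)} (hb : Bornology.IsBounded Ω)
    {u : E n → ℝ} {G : E n → E n} (hu : MemH10 Ω u G) (hbd : MemLp u ∞ (vol Ω)) {F : ℝ → ℝ}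
    (hF : ContDiff ℝ (⊤ : ℕ∞) F) (h0 : F 0 = 0) :
    MemH10 Ω (F ∘ u) (fun x => deriv F (u x) • G x) := by
  obtain ⟨R, hR, huR⟩ := exists_ae_abs_le hbd
  -- Only the values of `F` on `[-R, R]` matter. `F ∘ θ` agrees with `F` near that interval and has
  -- compact support because `F 0 = 0`, hence a bounded derivative.
  let β : ContDiffBump (0 : ℝ) := ⟨R + 1, R + 2, by positivity, by linarith⟩
  let θ : ℝ → ℝ := fun t => β t * t
  have hθ : ContDiff ℝ (⊤ : ℕ∞) θ := β.contDiff.mul contDiff_id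
  have hθc : HasCompactSupport θ := β.hasCompactSupport.mul_right
  have hH : ContDiff ℝ (⊤ : ℕ∞) (F ∘ θ) := hF.comp hθ
  have hHc : HasCompactSupport (F ∘ θ) := hθc.comp_left h0
  obtain ⟨C, hC⟩ := (hH.continuous_deriv (by simp)).bounded_above_of_compact_support hHc.deriv
  have heq : ∀ t, |t| ≤ R → (F ∘ θ) =ᶠ[𝓝 t] F := by
    intro t ht
    have : Metric.ball (0 : ℝ) (R + 1) ∈ 𝓝 t :=
      Metric.isOpen_ball.mem_nhds (by simpa using ht.trans_lt (by linarith))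
    filter_upwards [this] with y hy
    have : β y = 1 := β.one_of_mem_closedBall (Metric.ball_subset_closedBall hy)
    simp [θ, this]
  refine (hu.comp_of_deriv_bounded hb hH (by simp [θ, h0]) hC).congr hb ?_ ?_
  · filter_upwards [huR] with x hx
    exact (heq _ hx).eq_of_nhds
  · filter_upwards [huR] with x hx
    rw [(heq _ hx).deriv_eq]

/-! ### Exponential test functions and the energy estimate -/

theorem memLp_exp {α : Type*} [MeasurableSpace α] {ν : Measure α} [IsFiniteMeasure ν]
    {u : α → ℝ} (hu : MemLp u ∞ ν) (a : ℝ) (p : ℝ≥0∞) :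
    MemLp (fun x => Real.exp (a * u x)) p ν := by
  obtain ⟨R, hR, huR⟩ := exists_ae_abs_le hu
  refine MemLp.of_bound
    ((Real.continuous_exp.comp (continuous_const_mul a)).comp_aestronglyMeasurable hu.1)
    (Real.exp (|a| * R)) ?_
  filter_upwards [huR] with x hx
  rw [Real.norm_eq_abs, Real.abs_exp, Real.exp_le_exp]
  calc a * u x ≤ |a * u x| := le_abs_self _
    _ = |a| * |u x| := abs_mul _ _
    _ ≤ _ := by gcongr

theorem memH10_exp {n : ℕ} {Ω : Set (E n)} (hb : Bornology.IsBounded Ω)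
    {u : E n → ℝ} {G : E n → E n} (hu : MemH10 Ω u G) (hbd : MemLp u ∞ (vol Ω)) (a : ℝ) :
    MemH10 Ω (fun x => Real.exp (a * u x) - 1) (fun x => (a * Real.exp (a * u x)) • G x) := by
  have hF : ContDiff ℝ (⊤ : ℕ∞) fun t : ℝ => Real.exp (a * t) - 1 := by fun_prop
  have hd : ∀ t : ℝ, deriv (fun t : ℝ => Real.exp (a * t) - 1) t = a * Real.exp (a * t) := by
    intro t
    have h1 : HasDerivAt (fun t : ℝ => Real.exp (a * t) - 1) (Real.exp (a * t) * (a * 1)) t :=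
      (((hasDerivAt_id t).const_mul a).exp).sub_const 1
    rw [h1.deriv]; ring
  have := hu.comp hb hbd hF (by simp)
  simpa only [hd, Function.comp_def] using this

/-- Energy estimate obtained by testing the equation with `exp (κ u) - 1`. -/
theorem energy_estimate {n : ℕ} {Ω : Set (E n)} (hb : Bornology.IsBounded Ω)
    {μ V u : E n → ℝ} {G : E n → E n} (hu : MemH10 Ω u G) (hbd : MemLp u ∞ (vol Ω))
    (hu0 : 0 ≤ᵐ[vol Ω] u) (hμ : MemLp μ ∞ (vol Ω)) (hV : Integrable V (vol Ω))
    (hV0 : 0 ≤ᵐ[vol Ω] V) {m : ℝ} (hm : 0 < m) (hμm : ∀ᵐ x ∂vol Ω, μ x ≤ m)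
    (heq : ∀ (φ : E n → ℝ) (Φ : E n → E n), MemH10 Ω φ Φ → MemLp φ ∞ (vol Ω) →
      ∫ x in Ω, inner ℝ (G x) (Φ x) = ∫ x in Ω, (μ x * ‖G x‖ ^ 2 + V x) * φ x)
    {κ : ℝ} (hκ : 2 * m ≤ κ) :
    κ / 2 * ∫ x in Ω, Real.exp (κ * u x) * ‖G x‖ ^ 2 ≤ ∫ x in Ω, V x * Real.exp (κ * u x) := by
  have := isFiniteMeasure_vol hb
  have hκ0 : 0 < κ := by linarith
  have hexp := memLp_exp hbd κ ∞
  have hφ : MemLp (fun x => Real.exp (κ * u x) - 1) ∞ (vol Ω) := hexp.sub (memLp_const 1)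
  have hG2 : Integrable (fun x => ‖G x‖ ^ 2) (vol Ω) :=
    hu.memH1.memLp_grad.integrable_norm_pow two_ne_zero
  have hμG : Integrable (fun x => μ x * ‖G x‖ ^ 2) (vol Ω) := hG2.mul_of_top_right hμ
  have hEG : Integrable (fun x => Real.exp (κ * u x) * ‖G x‖ ^ 2) (vol Ω) :=
    hG2.mul_of_top_right hexp
  have hVE : Integrable (fun x => V x * Real.exp (κ * u x)) (vol Ω) := hV.mul_of_top_left hexp
  have h := heq _ _ (memH10_exp hb hu hbd κ) hφ
  have e1 : ∫ x in Ω, inner ℝ (G x) ((κ * Real.exp (κ * u x)) • G x) =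
      κ * ∫ x in Ω, Real.exp (κ * u x) * ‖G x‖ ^ 2 := by
    rw [← integral_const_mul]
    refine integral_congr_ae (Eventually.of_forall fun x => ?_)
    simp only [real_inner_smul_right, real_inner_self_eq_norm_sq]
    ring
  -- The `-1` in the test function is dropped at no cost since `V ≥ 0`. The coefficient `m` left in
  -- front of the gradient integral is at most `κ / 2`, half of what the left side of the equation
  -- provides.
  have e2 : ∫ x in Ω, (μ x * ‖G x‖ ^ 2 + V x) * (Real.exp (κ * u x) - 1) ≤
      m * (∫ x in Ω, Real.exp (κ * u x) * ‖G x‖ ^ 2) + ∫ x in Ω, V x * Real.exp (κ * u x) := by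
    rw [← integral_const_mul, ← integral_add (hEG.const_mul m) hVE]
    refine integral_mono_ae ((hμG.add hV).mul_of_top_left hφ) ((hEG.const_mul m).add hVE) ?_
    filter_upwards [hu0, hV0, hμm] with x hx0 hVx hμx
    have hE : 1 ≤ Real.exp (κ * u x) := Real.one_le_exp (mul_nonneg hκ0.le hx0)
    have h1 : μ x * ‖G x‖ ^ 2 * (Real.exp (κ * u x) - 1) ≤
        m * ‖G x‖ ^ 2 * (Real.exp (κ * u x) - 1) := by
      refine mul_le_mul_of_nonneg_right (mul_le_mul_of_nonneg_right hμx (by positivity)) ?_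
      linarith
    have h2 : 0 ≤ m * ‖G x‖ ^ 2 := by positivity
    have h3 : (0 : ℝ) ≤ V x := hVx
    nlinarith
  rw [e1] at h
  have hI : 0 ≤ ∫ x in Ω, Real.exp (κ * u x) * ‖G x‖ ^ 2 :=
    integral_nonneg fun x => by positivity
  nlinarith

/-! ### Moser iteration and the final bound on a finite measure space -/

section Iteration

variable {α : Type*} [MeasurableSpace α] {ν : Measure α} [IsFiniteMeasure ν]

theorem eLpNorm_exp {u : α → ℝ} (hu : MemLp u ∞ ν) (a : ℝ) {s : ℝ} (hs : 0 < s) :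
    eLpNorm (fun x => Real.exp (a * u x)) (ENNReal.ofReal s) ν =
      ENNReal.ofReal ((∫ x, Real.exp (a * s * u x) ∂ν) ^ (1 / s)) := by
  rw [(memLp_exp hu a _).eLpNorm_eq_integral_rpow_norm (by simpa using hs) ENNReal.ofReal_ne_top,
    ENNReal.toReal_ofReal hs.le, one_div]
  congr 3
  funext x
  rw [Real.norm_eq_abs, Real.abs_exp, ← Real.exp_mul]
  ring_nf

theorem integral_exp_mul_pos [NeZero ν] {u : α → ℝ} (hu : MemLp u ∞ ν) (a : ℝ) :
    0 < ∫ x, Real.exp (a * u x) ∂ν :=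
  integral_exp_pos ((memLp_exp hu a 1).integrable le_rfl)

/-- A function is essentially bounded by the supremum of its exponential means. -/
theorem ae_le_of_log_integral_exp_le [NeZero ν] {u : α → ℝ} (hu : MemLp u ∞ ν) {β : ℕ → ℝ}
    (hβ0 : ∀ j, 0 < β j) (hβ : Tendsto β atTop atTop) {B : ℝ}
    (hB : ∀ j, Real.log (∫ x, Real.exp (β j * u x) ∂ν) ≤ β j * B) : ∀ᵐ x ∂ν, u x ≤ B := by
  have key : ∀ A, B < A → ∀ᵐ x ∂ν, u x ≤ A := by
    intro A hA
    have hmeas : NullMeasurableSet {x | A < u x} ν :=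
      nullMeasurableSet_lt aemeasurable_const hu.1.aemeasurable
    by_contra hne
    rw [ae_iff] at hne
    simp only [not_le] at hne
    have hpos : 0 < ν.real {x | A < u x} := ENNReal.toReal_pos hne (measure_ne_top _ _)
    -- Restricting the integral to `{A < u}` gives this for every `j`; since `β j → ∞` and `B < A`,
    -- the right side tends to `-∞`.
    have h1 : ∀ j, Real.log (ν.real {x | A < u x}) ≤ β j * (B - A) := by
      intro j
      have hle : ν.real {x | A < u x} * Real.exp (β j * A) ≤ ∫ x, Real.exp (β j * u x) ∂ν := by
        have hint := (memLp_exp hu (β j) 1).integrable le_rfl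
        calc _ = ∫ x in {x | A < u x}, Real.exp (β j * A) ∂ν := by
              rw [setIntegral_const, smul_eq_mul]
          _ ≤ ∫ x in {x | A < u x}, Real.exp (β j * u x) ∂ν := by
              refine setIntegral_mono_on₀ (integrable_const _).integrableOn hint.integrableOn
                hmeas fun x hx => ?_
              exact Real.exp_le_exp.2 (mul_le_mul_of_nonneg_left (le_of_lt hx) (hβ0 j).le)
          _ ≤ _ := setIntegral_le_integral hint
              (Eventually.of_forall fun x => (Real.exp_pos _).le)
      have := Real.log_le_log (by positivity) hle
      rw [Real.log_mul hpos.ne' (Real.exp_ne_zero _), Real.log_exp] at this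
      linarith [hB j]
    have h2 : Tendsto (fun j => β j * (B - A)) atTop atBot :=
      hβ.atTop_mul_const_of_neg (by linarith)
    obtain ⟨j, hj⟩ := (h2.eventually (eventually_lt_atBot
      (Real.log (ν.real {x | A < u x})))).exists
    exact absurd (h1 j) (not_le.2 hj)
  have : ∀ᵐ x ∂ν, ∀ k : ℕ, u x ≤ B + 1 / ((k : ℝ) + 1) :=
    ae_all_iff.2 fun k => key _ (by linarith [Nat.one_div_pos_of_nat (α := ℝ) (n := k)])
  filter_upwards [this] with x hx
  have h3 : Tendsto (fun k : ℕ => B + 1 / ((k : ℝ) + 1)) atTop (𝓝 (B + 0)) :=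
    tendsto_const_nhds.add tendsto_one_div_add_atTop_nhds_zero_nat
  rw [add_zero] at h3
  exact ge_of_tendsto' h3 hx

/-- Moser iteration for the exponential means of a bounded function. -/
theorem exists_ae_le_log_integral_exp [NeZero ν] {a b m s p' : ℝ} (ha : 0 < a)
    (hm : 0 < m) (hp' : 0 < p') (hs : 2 * p' < s) :
    ∃ D : ℝ, 0 ≤ D ∧ ∀ u : α → ℝ, MemLp u ∞ ν →
      (∀ κ, 2 * m ≤ κ → (∫ x, Real.exp (κ * s / 2 * u x) ∂ν) ^ (1 / s) ≤
        (a + b * κ) * (∫ x, Real.exp (κ * p' * u x) ∂ν) ^ (1 / (2 * p'))) →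
      ∀ᵐ x ∂ν, u x ≤ Real.log (∫ x, Real.exp (2 * m * p' * u x) ∂ν) / (2 * m * p') + D := by
  set χ := s / (2 * p') with hχ
  have hs0 : 0 < s := by linarith
  have hχ1 : 1 < χ := by rw [hχ, lt_div_iff₀ (by positivity)]; linarith
  have hχ0 : 0 < χ := by linarith
  -- Since `χ ^ j ≥ 1`, the factor `a + b κ_j` is at most `A χ ^ j`. The maximum with `1` keeps `log
  -- A`, hence each `d j`, nonnegative.
  set A := max 1 (a + 2 * m * b) with hA
  have hA1 : 1 ≤ A := le_max_left _ _
  have hA0 : 0 < A := by linarith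
  let d : ℕ → ℝ := fun j => (Real.log A + j * Real.log χ) / m * (χ⁻¹) ^ j
  have hd0 : ∀ j, 0 ≤ d j := fun j => by
    have := Real.log_nonneg hA1
    have := Real.log_nonneg hχ1.le
    positivity
  have hd : Summable d := by
    have hχi : ‖χ⁻¹‖ < 1 := by
      rw [Real.norm_of_nonneg (by positivity)]; exact inv_lt_one_of_one_lt₀ hχ1
    have h1 := (summable_geometric_of_norm_lt_one hχi).mul_left (Real.log A / m)
    have h2 := (summable_pow_mul_geometric_of_norm_lt_one 1 hχi).mul_left (Real.log χ / m)
    refine (h1.add h2).congr fun j => ?_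
    simp only [d, pow_one]
    ring
  refine ⟨∑' j, d j, tsum_nonneg hd0, fun u hu hstep => ?_⟩
  let κ : ℕ → ℝ := fun j => 2 * m * χ ^ j
  have hκ0 : ∀ j, 0 < κ j := fun j => by positivity
  let J : ℝ → ℝ := fun t => ∫ x, Real.exp (t * u x) ∂ν
  have hJ : ∀ t, 0 < J t := fun t => integral_exp_mul_pos hu t
  -- `l j` is the logarithm of the `L^{κ_j p'}` norm of `exp u`. Taking logarithms in the reverse
  -- Hölder step and dividing by `κ_j / 2 = m χ ^ j` turns it into an additive recursion with
  -- summable error `d j`.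
  let l : ℕ → ℝ := fun j => Real.log (J (κ j * p')) / (κ j * p')
  have hl : ∀ j, l (j + 1) ≤ l j + d j := by
    intro j
    have hχj : 1 ≤ χ ^ j := one_le_pow₀ hχ1.le
    have h := hstep (κ j) (by simp only [κ]; nlinarith)
    -- The ratio `χ` is chosen so that the exponent gained at step `j` is the one required at step
    -- `j + 1`.
    have hκs : κ j * s / 2 = κ (j + 1) * p' := by
      simp only [κ, hχ, pow_succ]; field_simp
    have hab : a + b * κ j ≤ A * χ ^ j := by
      calc a + b * κ j ≤ a * χ ^ j + 2 * m * b * χ ^ j := by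
            simp only [κ]; nlinarith
        _ = (a + 2 * m * b) * χ ^ j := by ring
        _ ≤ _ := by gcongr; exact le_max_right _ _
    have h' : J (κ (j + 1) * p') ^ (1 / s) ≤ A * χ ^ j * J (κ j * p') ^ (1 / (2 * p')) := by
      rw [← hκs]
      exact h.trans (mul_le_mul_of_nonneg_right hab (Real.rpow_nonneg (hJ _).le _))
    have h2 := Real.log_le_log (Real.rpow_pos_of_pos (hJ _) _) h'
    rw [Real.log_mul (by positivity) (Real.rpow_pos_of_pos (hJ _) _).ne',
      Real.log_mul hA0.ne' (by positivity), Real.log_pow, Real.log_rpow (hJ _),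
      Real.log_rpow (hJ _)] at h2
    have e1 : 1 / s * Real.log (J (κ (j + 1) * p')) = κ j / 2 * l (j + 1) := by
      simp only [l]
      rw [← hκs]
      have := (hκ0 j).ne'
      field_simp
    have e2 : 1 / (2 * p') * Real.log (J (κ j * p')) = κ j / 2 * l j := by
      simp only [l]
      have := (hκ0 j).ne'
      field_simp
    have e3 : Real.log A + j * Real.log χ = κ j / 2 * d j := by
      simp only [d, κ, inv_pow]
      field_simp
    rw [e1, e2, e3, ← mul_add, add_comm (d j)] at h2
    exact le_of_mul_le_mul_left h2 (by have := hκ0 j; positivity)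
  have hl' : ∀ j, l j ≤ l 0 + ∑' j, d j := by
    have : ∀ j, l j ≤ l 0 + ∑ i ∈ Finset.range j, d i := by
      intro j
      induction j with
      | zero => simp
      | succ j ih => rw [Finset.sum_range_succ]; linarith [hl j]
    exact fun j => (this j).trans
      (add_le_add_right (hd.sum_le_tsum _ fun i _ => hd0 i) _)
  have h0 : l 0 = Real.log (∫ x, Real.exp (2 * m * p' * u x) ∂ν) / (2 * m * p') := by
    simp [l, κ, J]
  rw [← h0]
  have hβ0 : ∀ j, 0 < κ j * p' := fun j => mul_pos (hκ0 j) hp'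
  refine ae_le_of_log_integral_exp_le hu (β := fun j => κ j * p') hβ0 ?_ fun j => ?_
  · exact ((tendsto_pow_atTop_atTop_of_one_lt hχ1).const_mul_atTop (by positivity)).atTop_mul_const
      hp'
  · have := (div_le_iff₀ (hβ0 j)).1 (hl' j)
    linarith

/-- A bound by an exponential mean improves to a bound by a power mean. -/
theorem exists_ae_le_of_eLpNorm_le [NeZero ν] {b D θ M : ℝ} (hb : 0 < b) (hθ : 0 < θ)
    (hM : 0 < M) :
    ∃ C : ℝ, 0 < C ∧ ∀ u : α → ℝ, MemLp u ∞ ν →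
      (∀ᵐ x ∂ν, u x ≤ Real.log (∫ x, Real.exp (b * u x) ∂ν) / b + D) →
      eLpNorm u (ENNReal.ofReal θ) ν ≤ ENNReal.ofReal M → ∀ᵐ x ∂ν, u x ≤ C := by
  have hν : 0 < ν.real Set.univ := measureReal_univ_pos
  -- By definition of `B` below, `∫ exp (b u) = 2 δ exp (b B)`. The choice of `t` makes the part
  -- where `u < B - t` contribute at most `δ exp (b B)`, leaving measure at least `δ` for `{B - t ≤
  -- u}`.
  set δ := Real.exp (-(b * D)) / 2 with hδ
  have hδ0 : 0 < δ := by positivity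
  obtain ⟨t, ht0, ht⟩ : ∃ t : ℝ, 0 < t ∧ ν.real Set.univ * Real.exp (-(b * t)) ≤ δ := by
    refine ⟨max 1 (Real.log (ν.real Set.univ / δ) / b), by positivity, ?_⟩
    have h1 : Real.log (ν.real Set.univ / δ) ≤ b * max 1 (Real.log (ν.real Set.univ / δ) / b) := by
      rw [mul_comm, ← div_le_iff₀ hb]; exact le_max_right _ _
    rw [Real.log_le_iff_le_exp (by positivity), div_le_iff₀ hδ0] at h1
    rw [Real.exp_neg, ← div_eq_mul_inv, div_le_iff₀ (Real.exp_pos _)]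
    linarith
  refine ⟨t + M * δ ^ (-(1 / θ)), by positivity, fun u hu hB hMu => ?_⟩
  set B := Real.log (∫ x, Real.exp (b * u x) ∂ν) / b + D with hBdef
  suffices h : B ≤ t + M * δ ^ (-(1 / θ)) by
    filter_upwards [hB] with x hx using hx.trans h
  by_contra hcon
  rw [not_le] at hcon
  have hMδ : 0 < M * δ ^ (-(1 / θ)) := by positivity
  set S := {x | B - t ≤ u x} with hS
  have hSm : NullMeasurableSet S ν := nullMeasurableSet_le aemeasurable_const hu.1.aemeasurable
  have hint := (memLp_exp hu b 1).integrable le_rfl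
  have hJ : ∫ x, Real.exp (b * u x) ∂ν = Real.exp (b * (B - D)) := by
    rw [hBdef, add_sub_cancel_right, mul_div_cancel₀ _ hb.ne', Real.exp_log (integral_exp_mul_pos hu b)]
  have hle : Real.exp (b * (B - D)) ≤
      ν.real S * Real.exp (b * B) + ν.real Set.univ * Real.exp (b * (B - t)) := by
    rw [← hJ, ← integral_add_compl₀ hSm hint]
    refine add_le_add ?_ ?_
    · calc _ ≤ ∫ x in S, Real.exp (b * B) ∂ν := by
            refine setIntegral_mono_ae hint.integrableOn (integrable_const _).integrableOn ?_
            filter_upwards [hB] with x hx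
            gcongr
        _ = _ := by rw [setIntegral_const, smul_eq_mul]
    · calc _ ≤ ∫ x in Sᶜ, Real.exp (b * (B - t)) ∂ν := by
            refine setIntegral_mono_on₀ hint.integrableOn (integrable_const _).integrableOn
              hSm.compl fun x hx => ?_
            have : u x < B - t := not_le.1 hx
            gcongr
        _ = ν.real Sᶜ * _ := by rw [setIntegral_const, smul_eq_mul]
        _ ≤ _ := mul_le_mul_of_nonneg_right (measureReal_mono (Set.subset_univ _))
            (Real.exp_pos _).le
  have hSδ : δ ≤ ν.real S := by
    have e1 : Real.exp (b * (B - D)) = Real.exp (b * B) * (2 * δ) := by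
      rw [hδ, mul_div_cancel₀ _ two_ne_zero, ← Real.exp_add]; ring_nf
    have e2 : Real.exp (b * (B - t)) = Real.exp (b * B) * Real.exp (-(b * t)) := by
      rw [← Real.exp_add]; ring_nf
    rw [e1, e2] at hle
    have hpos := Real.exp_pos (b * B)
    have : Real.exp (b * B) * (2 * δ) ≤ Real.exp (b * B) * (ν.real S + δ) := by
      calc _ ≤ _ := hle
        _ = Real.exp (b * B) * (ν.real S + ν.real Set.univ * Real.exp (-(b * t))) := by ring
        _ ≤ _ := by gcongr
    have := le_of_mul_le_mul_left this hpos
    linarith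
  have hBt : 0 < B - t := by linarith
  -- Chebyshev's inequality on `{B - t ≤ u}`, which contradicts `B - t > M δ ^ (-(1 / θ))`.
  have hmark : ENNReal.ofReal ((B - t) ^ θ * δ) ≤ ENNReal.ofReal (M ^ θ) := by
    calc ENNReal.ofReal ((B - t) ^ θ * δ) = ENNReal.ofReal (B - t) ^ θ * ENNReal.ofReal δ := by
          rw [ENNReal.ofReal_mul (by positivity), ENNReal.ofReal_rpow_of_pos hBt]
      _ ≤ ENNReal.ofReal (B - t) ^ θ * ν {x | ENNReal.ofReal (B - t) ≤ ‖u x‖ₑ} := by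
          gcongr
          refine (ENNReal.ofReal_le_of_le_toReal hSδ).trans (measure_mono fun x hx => ?_)
          rw [Set.mem_ofPred_eq, ← ofReal_norm]
          exact ENNReal.ofReal_le_ofReal (le_trans hx (le_abs_self _))
      _ ≤ eLpNorm u (ENNReal.ofReal θ) ν ^ θ := by
          have := mul_meas_ge_le_pow_eLpNorm' ν (p := ENNReal.ofReal θ)
            (by simpa using hθ) ENNReal.ofReal_ne_top hu.1 (ENNReal.ofReal (B - t))
          rwa [ENNReal.toReal_ofReal hθ.le] at this
      _ ≤ ENNReal.ofReal M ^ θ := by gcongr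
      _ = _ := ENNReal.ofReal_rpow_of_pos hM
  have hfin := (ENNReal.ofReal_le_ofReal_iff (by positivity)).1 hmark
  have hlt : (M * δ ^ (-(1 / θ))) ^ θ < (B - t) ^ θ :=
    Real.rpow_lt_rpow hMδ.le (by linarith) hθ
  rw [Real.mul_rpow hM.le (by positivity), ← Real.rpow_mul hδ0.le, neg_mul,
    one_div_mul_cancel hθ.ne', Real.rpow_neg_one, ← div_eq_mul_inv, div_lt_iff₀ hδ0] at hlt
  linarith

end Iteration

/-! ### Reverse Hölder step, potential bound and choice of exponents -/

theorem integral_rpow_le_of_eLpNorm_le {α : Type*} [MeasurableSpace α] {ν : Measure α}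
    {f : α → ℝ} {p K : ℝ} (hp : 0 < p) (hK : 0 ≤ K) (hf : MemLp f (ENNReal.ofReal p) ν)
    (hf0 : 0 ≤ᵐ[ν] f) (h : eLpNorm f (ENNReal.ofReal p) ν ≤ ENNReal.ofReal K) :
    (∫ x, f x ^ p ∂ν) ^ (1 / p) ≤ K := by
  rw [hf.eLpNorm_eq_integral_rpow_norm (by simpa using hp) ENNReal.ofReal_ne_top,
    ENNReal.toReal_ofReal hp.le, ENNReal.ofReal_le_ofReal_iff hK] at h
  rw [one_div]
  refine le_trans (le_of_eq ?_) h
  congr 1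
  refine integral_congr_ae ?_
  filter_upwards [hf0] with x hx
  rw [Real.norm_of_nonneg hx]

/-- Reverse Hölder inequality between exponential means of a solution. -/
theorem exp_mean_step {n : ℕ} {Ω : Set (E n)} (hb : Bornology.IsBounded Ω) [NeZero (vol Ω)]
    {μ V u : E n → ℝ} {G : E n → E n} (hu : MemH10 Ω u G) (hbd : MemLp u ∞ (vol Ω))
    (hu0 : 0 ≤ᵐ[vol Ω] u) (hμ : MemLp μ ∞ (vol Ω)) (hV0 : 0 ≤ᵐ[vol Ω] V)
    {m : ℝ} (hm : 0 < m) (hμm : ∀ᵐ x ∂vol Ω, μ x ≤ m)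
    (heq : ∀ (φ : E n → ℝ) (Φ : E n → E n), MemH10 Ω φ Φ → MemLp φ ∞ (vol Ω) →
      ∫ x in Ω, inner ℝ (G x) (Φ x) = ∫ x in Ω, (μ x * ‖G x‖ ^ 2 + V x) * φ x)
    {p p' s K S : ℝ} (hpp : p.HolderConjugate p') (hs : 2 * p' < s) (hK : 0 ≤ K) (hS : 0 ≤ S)
    (hV : MemLp V (ENNReal.ofReal p) (vol Ω))
    (hVK : eLpNorm V (ENNReal.ofReal p) (vol Ω) ≤ ENNReal.ofReal K)
    (hSob : ∀ φ, IsTestFunction Ω φ → eLpNorm φ (ENNReal.ofReal s) (vol Ω) ≤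
      ENNReal.ofReal S * eLpNorm (gradient φ) 2 (vol Ω))
    {κ : ℝ} (hκ : 2 * m ≤ κ) :
    (∫ x in Ω, Real.exp (κ * s / 2 * u x)) ^ (1 / s) ≤
      (S + (vol Ω).real Set.univ ^ (1 / s - 1 / (2 * p')) + S * K * κ) *
        (∫ x in Ω, Real.exp (κ * p' * u x)) ^ (1 / (2 * p')) := by
  have := isFiniteMeasure_vol hb
  have hp0 : 0 < p := hpp.pos
  have hp'0 : 0 < p' := hpp.symm.pos
  have hp'1 : 1 < p' := hpp.symm.lt
  have hs0 : 0 < s := by linarith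
  have hκ0 : 0 < κ := by linarith
  have hν : 0 < (vol Ω).real Set.univ := measureReal_univ_pos
  set J := ∫ x in Ω, Real.exp (κ * p' * u x) with hJdef
  have hJ : 0 < J := integral_exp_mul_pos hbd _
  set Q := J ^ (1 / (2 * p')) with hQ
  have hQ0 : 0 < Q := Real.rpow_pos_of_pos hJ _
  have hQ2 : Q ^ 2 = J ^ (1 / p') := by
    rw [hQ, ← Real.rpow_natCast, ← Real.rpow_mul hJ.le]
    congr 1; push_cast; field_simp
  set X := ∫ x in Ω, Real.exp (κ * u x) * ‖G x‖ ^ 2 with hX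
  have hX0 : 0 ≤ X := integral_nonneg fun x => by positivity
  have hVE : ∫ x in Ω, V x * Real.exp (κ * u x) ≤ K * Q ^ 2 := by
    have h1 := integral_mul_le_Lp_mul_Lq_of_nonneg hpp hV0
      (Eventually.of_forall fun x => (Real.exp_pos (κ * u x)).le) hV
      (memLp_exp hbd κ (ENNReal.ofReal p'))
    have h2 : ∫ x in Ω, Real.exp (κ * u x) ^ p' = J := by
      rw [hJdef]
      congr 1; funext x
      rw [← Real.exp_mul]; ring_nf
    rw [h2, ← hQ2] at h1
    exact h1.trans (mul_le_mul_of_nonneg_right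
      (integral_rpow_le_of_eLpNorm_le hp0 hK hV hV0 hVK) (by positivity))
  have hVint : Integrable V (vol Ω) :=
    hV.integrable (by simpa using ENNReal.ofReal_le_ofReal hpp.lt.le)
  have hen := (energy_estimate hb hu hbd hu0 hμ hVint hV0 hm hμm heq hκ).trans hVE
  -- The energy estimate gives the sharper factor `(K κ / 2) ^ (1 / 2)`; enlarging it to `1 + K κ`
  -- makes the final constant affine in `κ`.
  have hgrad : eLpNorm (fun x => (κ / 2 * Real.exp (κ / 2 * u x)) • G x) 2 (vol Ω) ≤
      ENNReal.ofReal ((1 + K * κ) * Q) := by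
    have hv := (memH10_exp hb hu hbd (κ / 2)).memH1.memLp_grad
    rw [hv.eLpNorm_eq_integral_rpow_norm two_ne_zero ENNReal.ofNat_ne_top]
    refine ENNReal.ofReal_le_ofReal ?_
    have h1 : ∫ x in Ω, ‖(κ / 2 * Real.exp (κ / 2 * u x)) • G x‖ ^ (2 : ℝ≥0∞).toReal =
        κ ^ 2 / 4 * X := by
      rw [hX, ← integral_const_mul]
      congr 1; funext x
      have : Real.exp (κ * u x) = Real.exp (κ / 2 * u x) ^ 2 := by
        rw [← Real.exp_nat_mul]; congr 1; push_cast; ring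
      rw [this, norm_smul, Real.norm_of_nonneg (by positivity), ENNReal.toReal_ofNat,
        Real.rpow_ofNat]
      ring
    rw [h1, ENNReal.toReal_ofNat, ← one_div, ← Real.sqrt_eq_rpow]
    refine Real.sqrt_le_iff.2 ⟨by positivity, ?_⟩
    calc κ ^ 2 / 4 * X = κ / 2 * (κ / 2 * X) := by ring
      _ ≤ κ / 2 * (K * Q ^ 2) := by gcongr
      _ = (K * κ / 2) * Q ^ 2 := by ring
      _ ≤ (1 + K * κ) ^ 2 * Q ^ 2 := by
          have : 0 ≤ K * κ := by positivity
          gcongr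
          nlinarith
      _ = _ := by ring
  -- Adding back the constant `1` costs only a multiple of `Q`, because `u ≥ 0` forces `J ≥ |Ω|`.
  have hone : eLpNorm (fun _ : E n => (1 : ℝ)) (ENNReal.ofReal s) (vol Ω) ≤
      ENNReal.ofReal ((vol Ω).real Set.univ ^ (1 / s - 1 / (2 * p')) * Q) := by
    rw [eLpNorm_const _ (by simpa using hs0) (NeZero.ne _), enorm_one, one_mul,
      ENNReal.toReal_ofReal hs0.le, ← ofReal_measureReal (measure_ne_top (vol Ω) Set.univ),
      ENNReal.ofReal_rpow_of_pos hν]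
    refine ENNReal.ofReal_le_ofReal ?_
    calc (vol Ω).real Set.univ ^ (1 / s)
        = (vol Ω).real Set.univ ^ (1 / s - 1 / (2 * p')) *
          (vol Ω).real Set.univ ^ (1 / (2 * p')) := by
          rw [← Real.rpow_add hν, sub_add_cancel]
      _ ≤ _ := by
          rw [hQ]
          gcongr
          have h1 : ∫ _ in Ω, (1 : ℝ) ≤ J := by
            refine integral_mono_ae (integrable_const _)
              ((memLp_exp hbd (κ * p') 1).integrable le_rfl) ?_
            filter_upwards [hu0] with x hx
            exact Real.one_le_exp (mul_nonneg (by positivity) hx)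
          simpa using h1
  have hmain : ENNReal.ofReal ((∫ x in Ω, Real.exp (κ / 2 * s * u x)) ^ (1 / s)) ≤
      ENNReal.ofReal (S * ((1 + K * κ) * Q)) +
        ENNReal.ofReal ((vol Ω).real Set.univ ^ (1 / s - 1 / (2 * p')) * Q) := by
    have hvm := (memH10_exp hb hu hbd (κ / 2)).memH1.memLp.1
    have hsplit : (fun x => Real.exp (κ / 2 * u x)) =
        (fun x => Real.exp (κ / 2 * u x) - 1) + fun _ => (1 : ℝ) := by
      funext x; simp
    rw [← eLpNorm_exp hbd (κ / 2) hs0, hsplit, ENNReal.ofReal_mul hS]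
    refine (eLpNorm_add_le hvm aestronglyMeasurable_const
      (by simpa using ENNReal.ofReal_le_ofReal (by linarith : (1 : ℝ) ≤ s))).trans ?_
    refine add_le_add ?_ hone
    exact ((memH10_exp hb hu hbd (κ / 2)).eLpNorm_le ENNReal.ofReal_ne_top hSob).trans (by gcongr)
  rw [← ENNReal.ofReal_add (by positivity) (by positivity),
    ENNReal.ofReal_le_ofReal_iff (by positivity)] at hmain
  rw [show κ * s / 2 = κ / 2 * s by ring]
  refine hmain.trans (le_of_eq ?_)
  ring

/-- Uniform bound of the zero order terms. -/
theorem exists_eLpNorm_potential_le {α : Type*} [MeasurableSpace α] {ν : Measure α}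
    [IsFiniteMeasure ν] {c h : α → ℝ} (hc : MemLp c ∞ ν) (hc0 : 0 ≤ᵐ[ν] c) {p q r : ℝ}
    {ε γ M : ℝ} (hε : 0 < ε) (hp : 1 ≤ p) (hpr : p ≤ r) (hpq : p ≤ q * (1 + ε)) (hq : 0 < q)
    (hh : MemLp h (ENNReal.ofReal r) ν) :
    ∃ K : ℝ, 0 ≤ K ∧ ∀ lam : ℝ, 0 ≤ lam → lam ≤ γ → ∀ u : α → ℝ, MemLp u ∞ ν → 0 ≤ᵐ[ν] u →
      eLpNorm (fun x => c x * u x ^ (1 + ε)) (ENNReal.ofReal q) ν ≤ ENNReal.ofReal M →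
      MemLp (fun x => lam * c x * u x + h x) (ENNReal.ofReal p) ν ∧
      eLpNorm (fun x => lam * c x * u x + h x) (ENNReal.ofReal p) ν ≤ ENNReal.ofReal K := by
  obtain ⟨C, hC, hcC⟩ := exists_ae_abs_le hc
  have hε1 : 0 < 1 + ε := by linarith
  have hhp : MemLp h (ENNReal.ofReal p) ν := hh.mono_exponent (ENNReal.ofReal_le_ofReal hpr)
  set W : ℝ≥0∞ := (ENNReal.ofReal (C ^ ε) * ENNReal.ofReal M) ^ (1 / (1 + ε)) *
    ν Set.univ ^ (1 / p - 1 / (q * (1 + ε))) with hW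
  have hWfin : W ≠ ∞ := by
    refine ENNReal.mul_ne_top (ENNReal.rpow_ne_top_of_nonneg (by positivity)
      (ENNReal.mul_ne_top ENNReal.ofReal_ne_top ENNReal.ofReal_ne_top))
      (ENNReal.rpow_ne_top_of_nonneg (sub_nonneg.2 ?_) (measure_ne_top _ _))
    exact one_div_le_one_div_of_le (by linarith) hpq
  set T : ℝ≥0∞ := ENNReal.ofReal γ * W + eLpNorm h (ENNReal.ofReal p) ν with hT
  have hTfin : T ≠ ∞ :=
    ENNReal.add_ne_top.2 ⟨ENNReal.mul_ne_top ENNReal.ofReal_ne_top hWfin, hhp.2.ne⟩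
  refine ⟨T.toReal, ENNReal.toReal_nonneg, fun lam hl0 hlγ u hu hu0 hM => ?_⟩
  have hcu : MemLp (fun x => c x * u x) ∞ ν := hu.mul hc
  have hcup : MemLp (fun x => c x * u x) (ENNReal.ofReal p) ν := hcu.mono_exponent le_top
  have hlcu : MemLp (fun x => lam * c x * u x) (ENNReal.ofReal p) ν := by
    simpa only [mul_assoc] using hcup.const_mul lam
  refine ⟨hlcu.add hhp, ?_⟩
  rw [ENNReal.ofReal_toReal hTfin]
  refine (eLpNorm_add_le hlcu.1 hhp.1 (by simpa using ENNReal.ofReal_le_ofReal hp)).trans ?_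
  refine add_le_add ?_ le_rfl
  have hW' : eLpNorm (fun x => c x * u x) (ENNReal.ofReal p) ν ≤ W := by
    refine (eLpNorm_le_eLpNorm_mul_rpow_measure_univ (ENNReal.ofReal_le_ofReal hpq) hcu.1).trans ?_
    rw [hW, ENNReal.toReal_ofReal (by linarith), ENNReal.toReal_ofReal (by positivity)]
    gcongr
    have h1 := eLpNorm_norm_rpow (p := ENNReal.ofReal q) (μ := ν) (fun x => c x * u x) hε1
    rw [← ENNReal.ofReal_mul hq.le] at h1
    rw [one_div, ENNReal.le_rpow_inv_iff hε1, ← h1]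
    -- `(c u)^{1+ε} = c^ε · c u^{1+ε}`, with `c^ε ≤ C^ε`: the weight `c` appears to the first power
    -- in the hypothesis.
    have hle : ∀ᵐ x ∂ν, ‖‖c x * u x‖ ^ (1 + ε)‖ ≤ C ^ ε * ‖c x * u x ^ (1 + ε)‖ := by
      filter_upwards [hcC, hc0, hu0] with x hx hcx hux
      have hcx' : 0 ≤ c x := hcx
      have hux' : 0 ≤ u x := hux
      rw [abs_of_nonneg hcx'] at hx
      rw [Real.norm_of_nonneg (mul_nonneg hcx' hux'), Real.norm_of_nonneg (by positivity),
        Real.norm_of_nonneg (by positivity), Real.mul_rpow hcx' hux', ← mul_assoc]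
      gcongr
      rw [Real.rpow_add_of_nonneg hcx' zero_le_one hε.le, Real.rpow_one, mul_comm]
      gcongr
    exact (eLpNorm_le_mul_eLpNorm_of_ae_le_mul hle _).trans (by gcongr)
  calc eLpNorm (fun x => lam * c x * u x) (ENNReal.ofReal p) ν
      ≤ ENNReal.ofReal lam * eLpNorm (fun x => c x * u x) (ENNReal.ofReal p) ν := by
        refine eLpNorm_le_mul_eLpNorm_of_ae_le_mul (Eventually.of_forall fun x => ?_) _
        rw [mul_assoc, norm_mul, Real.norm_of_nonneg hl0]
    _ ≤ _ := by gcongr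

/-- For `n ≥ 3`, with `1/s = 1/2 - 1/n` and `1/(2p') = 1/2 - 1/(2p)`, the gap `2p' < s` is exactly
`p > n/2`. For `n ≤ 2` any finite `s` is a Sobolev exponent, so `2p' + 1` will do. -/
theorem exists_sobolev_exponents {n : ℕ} (hn : 1 ≤ n) {p : ℝ} (hp1 : 1 < p)
    (hpn : (n : ℝ) / 2 < p) : ∃ p' s : ℝ, p.HolderConjugate p' ∧ 2 * p' < s ∧
      (3 ≤ n → s⁻¹ = 2⁻¹ - (n : ℝ)⁻¹) := by
  have hpp : p.HolderConjugate p.conjExponent := Real.HolderConjugate.conjExponent hp1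
  refine ⟨p.conjExponent, if 3 ≤ n then (2⁻¹ - (n : ℝ)⁻¹)⁻¹ else 2 * p.conjExponent + 1, hpp, ?_,
    fun h3 => by simp [h3]⟩
  split_ifs with h3
  · have hn0 : (0 : ℝ) < n := by exact_mod_cast hn
    have hn3 : (3 : ℝ) ≤ n := by exact_mod_cast h3
    have hinv := hpp.inv_add_inv_eq_one
    have h1 : p⁻¹ < 2 * (n : ℝ)⁻¹ := by
      have := inv_strictAnti₀ (by positivity) hpn
      rwa [inv_div, div_eq_mul_inv] at this
    have hpos : 0 < 2⁻¹ - (n : ℝ)⁻¹ := by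
      have := inv_anti₀ (by norm_num) hn3
      linarith
    rw [lt_inv_comm₀ (by have := hpp.symm.pos; positivity) hpos, mul_inv]
    linarith
  · linarith

end GradientGrowth

/-! ### Proof of the main estimate -/

theorem proposition1 (n : ℕ) (hn : 1 ≤ n) (Ω : Set (GradientGrowth.E n))
    (hΩ : GradientGrowth.IsBoundedC2Domain Ω)
    (μ c h : GradientGrowth.E n → ℝ)
    (hμ : MemLp μ ∞ (GradientGrowth.vol Ω)) (hc : MemLp c ∞ (GradientGrowth.vol Ω))
    (r : ℝ) (hr : max 1 ((n : ℝ) / 2) < r)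
    (hh : MemLp h (ENNReal.ofReal r) (GradientGrowth.vol Ω))
    (hμ0 : GradientGrowth.NonnegNontrivial Ω μ)
    (hc0 : GradientGrowth.NonnegNontrivial Ω c)
    (hh0 : GradientGrowth.NonnegNontrivial Ω h)
    (q : ℝ) (hq3 : 3 ≤ n → q = (n : ℝ) / 2) (hq2 : n ≤ 2 → 1 < q)
    (ε α M : ℝ) (hε : 0 < ε) (hα : 0 < α) (hM : 0 < M) :
    ∃ C₁ : ℝ, 0 < C₁ ∧
      ∀ lam : ℝ, 0 ≤ lam → lam ≤ GradientGrowth.firstEigenvalue Ω c →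
      ∀ u : GradientGrowth.E n → ℝ, 0 ≤ᵐ[GradientGrowth.vol Ω] u →
        GradientGrowth.IsSolution Ω μ c h lam u →
        eLpNorm (fun x => c x * u x ^ (1 + ε)) (ENNReal.ofReal q) (GradientGrowth.vol Ω)
            + eLpNorm u (ENNReal.ofReal α) (GradientGrowth.vol Ω) ≤ ENNReal.ofReal M →
        eLpNorm u ∞ (GradientGrowth.vol Ω) ≤ ENNReal.ofReal C₁ := by
  open GradientGrowth in
  have hb := hΩ.isBounded
  have := isFiniteMeasure_vol hb
  have hpos : 0 < (vol Ω) Set.univ := by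
    rw [Measure.restrict_apply_univ]
    exact hΩ.isOpen.measure_pos _ hΩ.isConnected.nonempty
  have : NeZero (vol Ω) := ⟨fun h0 => by simp [h0] at hpos⟩
  have hq1 : 1 < q := by
    rcases Nat.lt_or_ge 2 n with h3 | h2
    · have : (3 : ℝ) ≤ n := by exact_mod_cast h3
      rw [hq3 h3]; linarith
    · exact hq2 h2
  have hqn : (n : ℝ) / 2 ≤ q := by
    rcases Nat.lt_or_ge 2 n with h3 | h2
    · exact (hq3 h3).ge
    · have : (n : ℝ) ≤ 2 := by exact_mod_cast h2
      linarith
  have hqε : q < q * (1 + ε) := by nlinarith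
  obtain ⟨hr1, hrn⟩ := max_lt_iff.1 hr
  -- `h` lies in `L^r` and `c u` is bounded in `L^{q(1+ε)}`; both exponents exceed `n/2` and `1`.
  set p := min r (q * (1 + ε)) with hp
  have hp1 : 1 < p := lt_min hr1 (hq1.trans hqε)
  have hpn : (n : ℝ) / 2 < p := lt_min hrn (hqn.trans_lt hqε)
  obtain ⟨p', s, hpp, hs, hs3⟩ := exists_sobolev_exponents hn hp1 hpn
  have hp'1 : 1 < p' := hpp.symm.lt
  obtain ⟨S, hS, hSob⟩ := exists_eLpNorm_le_eLpNorm_gradient hn hb (s := s) (by linarith) hs3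
  rw [← ENNReal.ofReal_toReal hS] at hSob
  obtain ⟨K, hK, hKV⟩ := exists_eLpNorm_potential_le (γ := firstEigenvalue Ω c) (M := M)
    hc hc0.1 hε hp1.le (min_le_left _ _) (min_le_right _ _) (by linarith) hh
  obtain ⟨m, hm, hμm⟩ := exists_ae_abs_le hμ
  have hvol : 0 < (vol Ω).real Set.univ := measureReal_univ_pos
  -- `D`, and then `C`, are fixed before `lam` and `u`: they depend only on the data, `S`, `K`, `m`
  -- and the exponents.
  obtain ⟨D, -, hD⟩ := exists_ae_le_log_integral_exp (ν := vol Ω)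
    (a := S.toReal + (vol Ω).real Set.univ ^ (1 / s - 1 / (2 * p'))) (b := S.toReal * K)
    (by positivity) hm (by linarith) hs
  obtain ⟨C, hC, hCu⟩ := exists_ae_le_of_eLpNorm_le (ν := vol Ω) (b := 2 * m * p') (D := D)
    (by positivity) hα hM
  refine ⟨C, hC, fun lam hl0 hlγ u hu0 ⟨G, hG, hbd, heq⟩ hsum => ?_⟩
  obtain ⟨hV, hVK⟩ := hKV lam hl0 hlγ u hbd hu0 (le_self_add.trans hsum)
  have hV0 : 0 ≤ᵐ[vol Ω] fun x => lam * c x * u x + h x := by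
    filter_upwards [hc0.1, hu0, hh0.1] with x h1 h2 h3
    exact add_nonneg (mul_nonneg (mul_nonneg hl0 h1) h2) h3
  have hle := hCu u hbd (hD u hbd fun κ hκ => exp_mean_step hb hG hbd hu0 hμ hV0 hm
    (hμm.mono fun x hx => (le_abs_self _).trans hx) (by simpa only [add_assoc] using heq) hpp hs hK
    ENNReal.toReal_nonneg hV hVK hSob hκ) (le_add_self.trans hsum)
  rw [eLpNorm_exponent_top]
  refine eLpNormEssSup_le_of_ae_bound ?_
  filter_upwards [hle, hu0] with x hx hx0
  rwa [Real.norm_of_nonneg hx0]
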